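/- Let $0<\alpha<1$. There is a constant $C_6>0$, depending only on $\alpha$, such that the following holds for every $n\in\mathbb N$ and every $R>0$. Put $D=\{z\in\mathbb C : |z|\le R\}$. For $f:D^n\to\mathbb C$ and distinct indices $i_1,\dots,i_k\in\{1,\dots,n\}$ let $\Delta_{i_1\cdots i_k}f$ be the iterated difference of $f$ in the variables $z_{i_1},\dots,z_{i_k}$, where $\Delta_i f=f(\dots,z_i,\dots)-f(\dots,z_i',\dots)$ and $\Delta_{i_1\cdots i_k}f=\Delta_{i_k}\Delta_{i_1\cdots i_{k-1}}f$, and let $$H^{(k)}_\alpha[f]=\sup\frac{|\Delta_{i_1\cdots i_k}f|}{|z_{i_1}-z_{i_1}'|^\alpha\cdots|z_{i_k}-z_{i_k}'|^\alpha},\qquad H^{(0)}_\alpha[f]=\sup_{D^n}|f|,$$ the supremum being over all distinct $i_1,\dots,i_k$ and all points of $D^n$ with $z_{i_j}\ne z'_{i_j}$ $(1\le j\le k)$. Let $\mathcal C^\alpha(D^n)$ be the set of those $f$ for which $H^{(k)}_\alpha[f]<\infty$ for $k=0,\dots,n$, with the norm $$\|f\|=\sum_{k=0}^n\frac{(2R)^{k\alpha}}{k!}H^{(k)}_\alpha[f].$$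 For $1\le j\le n$ let $$T_jf(z)=\frac{-1}{2\pi i}\int_D\frac{f(z_1,\dots,z_{j-1},\zeta,z_{j+1},\dots,z_n)}{\zeta-z_j}\,d\bar\zeta\wedge d\zeta,\qquad \bar T_jf(z)=\frac{-1}{2\pi i}\int_D\frac{f(z_1,\dots,z_{j-1},\zeta,z_{j+1},\dots,z_n)}{\bar\zeta-\bar z_j}\,d\bar\zeta\wedge d\zeta,$$ and, for $\mu,\nu\in\mathbb N^n$ (entries may be $0$), let $T^\mu\bar T^\nu=T_1^{\mu_1}\cdots T_n^{\mu_n}\bar T_1^{\nu_1}\cdots\bar T_n^{\nu_n}$ and $|\mu|=\sum_j\mu_j$. If $f\in\mathcal C^\alpha(D^n)$ and $|\mu|+|\nu|=m$, then $T^\mu\bar T^\nu f\in\mathcal C^\alpha(D^n)$ and $$\|T^\mu\bar T^\nu f\|\le (C_6R)^m\,\|f\|.$$ -/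

import Mathlib

open Metric

noncomputable section

namespace Polydisc

/-- The closed polydisc `Dⁿ = {z : |z_j| ≤ R for all j}` in `ℂⁿ`. -/
def polydisc (n : ℕ) (R : ℝ) : Set (Fin n → ℂ) :=
  {z | ∀ j, z j ∈ closedBall (0 : ℂ) R}

/-- The difference `Δ_i f` in the `i`-th variable, between the points `z` and
`(z_1, …, z_{i-1}, w, z_{i+1}, …, z_n)`. -/
def diff {n : ℕ} (i : Fin n) (w : ℂ) (f : (Fin n → ℂ) → ℂ) : (Fin n → ℂ) → ℂ :=
  fun z => f z - f (Function.update z i w)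

/-- The iterated difference `Δ_{i_1 ⋯ i_k} f = Δ_{i_k} (Δ_{i_1 ⋯ i_{k-1}} f)` for the list
`l = [i_1, …, i_k]`; the second value of the variable `z_i` is `z' i`. -/
def iterDiff {n : ℕ} (l : List (Fin n)) (z' : Fin n → ℂ) (f : (Fin n → ℂ) → ℂ) :
    (Fin n → ℂ) → ℂ :=
  l.foldl (fun g i => diff i (z' i) g) f

/-- The set of absolute values of all `k`-th order `α`-Hölder difference quotients of `f` on the
polydisc: `|Δ_{i_1 ⋯ i_k} f| / (|z_{i_1} - z'_{i_1}|^α ⋯ |z_{i_k} - z'_{i_k}|^α)` with distinct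
`i_1, …, i_k`. For `k = 0` it is the set of the values `|f z|`. -/
def quotientSet {n : ℕ} (R α : ℝ) (k : ℕ) (f : (Fin n → ℂ) → ℂ) : Set ℝ :=
  {q | ∃ l : List (Fin n), l.Nodup ∧ l.length = k ∧
    ∃ z ∈ polydisc n R, ∃ z' ∈ polydisc n R, (∀ i ∈ l, z i ≠ z' i) ∧
      q = ‖iterDiff l z' f z‖ / (l.map fun i => ‖z i - z' i‖ ^ α).prod}

/-- `H_α^{(k)}[f]`, the supremum of the `k`-th order `α`-Hölder difference quotients. -/
def holderSup {n : ℕ} (R α : ℝ) (k : ℕ) (f : (Fin n → ℂ) → ℂ) : ℝ :=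
  sSup (quotientSet R α k f)

/-- `f ∈ 𝒞^α(Dⁿ)`: `H_α^{(k)}[f]` is finite for `k = 0, …, n`. (Only the values of `f` on the
polydisc matter.) -/
def MemHolder {n : ℕ} (R α : ℝ) (f : (Fin n → ℂ) → ℂ) : Prop :=
  ∀ k ≤ n, BddAbove (quotientSet R α k f)

/-- The norm `‖f‖ = ∑_{k=0}^n (2R)^{kα} / k! · H_α^{(k)}[f]` of `𝒞^α(Dⁿ)`. -/
def holderNorm {n : ℕ} (R α : ℝ) (f : (Fin n → ℂ) → ℂ) : ℝ :=
  ∑ k ∈ Finset.range (n + 1),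
    (2 * R) ^ ((k : ℝ) * α) / (k.factorial : ℝ) * holderSup R α k f

/-- `T_j f(z) = -1/(2πi) ∫_D f(z_1, …, ζ, …, z_n) / (ζ - z_j) dζ̄ ∧ dζ`, with `ζ` in the `j`-th
place; here `dζ̄ ∧ dζ = 2i dx ∧ dy` is `2i` times Lebesgue measure. -/
def opT {n : ℕ} (R : ℝ) (j : Fin n) (f : (Fin n → ℂ) → ℂ) : (Fin n → ℂ) → ℂ :=
  fun z => (-1 / (2 * (Real.pi : ℂ) * Complex.I)) *
    ∫ ζ in closedBall (0 : ℂ) R,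
      f (Function.update z j ζ) / (ζ - z j) * (2 * Complex.I)

/-- `T̄_j f(z) = -1/(2πi) ∫_D f(z_1, …, ζ, …, z_n) / (ζ̄ - z̄_j) dζ̄ ∧ dζ`, with `ζ` in the `j`-th
place. -/
def opTbar {n : ℕ} (R : ℝ) (j : Fin n) (f : (Fin n → ℂ) → ℂ) : (Fin n → ℂ) → ℂ :=
  fun z => (-1 / (2 * (Real.pi : ℂ) * Complex.I)) *
    ∫ ζ in closedBall (0 : ℂ) R,
      f (Function.update z j ζ) / (starRingEnd ℂ ζ - starRingEnd ℂ (z j)) * (2 * Complex.I)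

/-- `A_1^{μ_1} A_2^{μ_2} ⋯ A_n^{μ_n} f` for operators `A_1, …, A_n` and a multi-index `μ`. -/
def multiPow {n : ℕ} {X : Type*} (A : Fin n → X → X) (μ : Fin n → ℕ) (f : X) : X :=
  (List.finRange n).foldr (fun j g => (A j)^[μ j] g) f

/-- The high-order Green operator
`T^μ T̄^ν f = T_1^{μ_1} ⋯ T_n^{μ_n} T̄_1^{ν_1} ⋯ T̄_n^{ν_n} f`. -/
def green {n : ℕ} (R : ℝ) (μ ν : Fin n → ℕ) (f : (Fin n → ℂ) → ℂ) : (Fin n → ℂ) → ℂ :=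
  multiPow (opT R) μ (multiPow (opTbar R) ν f)

end Polydisc

end

open MeasureTheory Set

namespace Polydisc

/-! Everything reduces to one operator: if `T` is `T_j` or `T̄_j`, then `‖T g‖ ≤ C R ‖g‖` with `C =
4 + 16 / (1 - α)`. Iterating this `m` times gives the theorem. Both kinds of operator are treated at
once, with kernel `1 / (φ ζ - φ a)` for an isometry `φ`.

Differences in variables other than `z_j` commute with `T`. For a quotient of order `k` not
involving `z_j`, the sup bound of the one-variable transform gives the factor `4R` with the order
kept. If `z_j` is involved, its difference is taken last: the transform of a bounded function is
`α`-Hölder, so the quotient is controlled by `H^{(k-1)}` with factor `8 / (1 - α) * (2R)^(1-α)`. The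
weights `(2R)^{kα} / k!` turn this shift of order into a factor `2R * 8 / (1 - α)`, uniformly in `k`
and `n`. The two cases are `norm_iterDiff_opCauchy_le_of_notMem` and
`norm_iterDiff_opCauchy_le_of_mem`; `holderNorm_opCauchy_le` sums them. -/

/-! ### One-variable estimates for the Cauchy transform. -/

/-- Integrability and size of `‖ζ - a‖ ^ (-s)`, `s < 2`, over a disc containing `a`. -/
lemma riesz_kernel_bound {R s : ℝ} (hR : 0 < R) (hs : s < 2) {a : ℂ}
    (ha : a ∈ closedBall (0 : ℂ) R) :
    IntegrableOn (fun ζ : ℂ => ‖ζ - a‖ ^ (-s)) (closedBall 0 R) ∧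
      ∫ ζ in closedBall (0 : ℂ) R, ‖ζ - a‖ ^ (-s) ≤
        2 * Real.pi * ((2 * R) ^ (2 - s) / (2 - s)) := by
  -- The radial profile is cut at `2R` because the disc lies within distance `2R` of `a`; the
  -- integral over the plane is then computed in polar coordinates.
  set g : ℝ → ℝ := (Iic (2 * R)).indicator fun y => y ^ (-s) with hg
  have hset : Ioi (0 : ℝ) ∩ Iic (2 * R) = Ioc 0 (2 * R) := by ext; simp
  have hmul : ∀ y ∈ Ioi (0 : ℝ), y ^ (Module.finrank ℝ ℂ - 1) • g y =
      (Iic (2 * R)).indicator (fun y => y ^ (1 - s)) y := by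
    intro y hy
    have hy : 0 < y := hy
    by_cases h : y ∈ Iic (2 * R)
    · simp only [hg, indicator_of_mem h, Complex.finrank_real_complex, smul_eq_mul]
      rw [sub_eq_add_neg, Real.rpow_add hy, Real.rpow_one]
      norm_num
    · simp [hg, indicator_of_notMem h]
  have hgi : Integrable (fun ζ : ℂ => g ‖ζ‖) := by
    rw [integrable_fun_norm_addHaar, integrableOn_congr_fun hmul measurableSet_Ioi,
      IntegrableOn, integrable_indicator_iff measurableSet_Iic, IntegrableOn,
      Measure.restrict_restrict measurableSet_Iic, inter_comm, hset]
    have := intervalIntegral.intervalIntegrable_rpow' (a := 0) (b := 2 * R) (r := 1 - s)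
      (by linarith)
    rwa [intervalIntegrable_iff_integrableOn_Ioc_of_le (by positivity)] at this
  have hgint : ∫ ζ : ℂ, g ‖ζ‖ = 2 * Real.pi * ((2 * R) ^ (2 - s) / (2 - s)) := by
    rw [integral_fun_norm_addHaar, setIntegral_congr_fun measurableSet_Ioi hmul,
      setIntegral_indicator measurableSet_Iic, hset,
      ← intervalIntegral.integral_of_le (by positivity), integral_rpow (Or.inl (by linarith)),
      Real.zero_rpow (by linarith), measureReal_def, Complex.volume_ball]
    simp only [Complex.finrank_real_complex, nsmul_eq_mul, smul_eq_mul]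
    norm_num
    rw [show 1 - s + 1 = 2 - s by ring]
    ring
  have hgi' : Integrable (fun ζ : ℂ => g ‖ζ - a‖) := hgi.comp_sub_right a
  have heq : EqOn (fun ζ : ℂ => g ‖ζ - a‖) (fun ζ => ‖ζ - a‖ ^ (-s)) (closedBall 0 R) := by
    intro ζ hζ
    have : ‖ζ - a‖ ≤ 2 * R := by
      have h1 : ‖ζ‖ ≤ R := by simpa using hζ
      have h2 : ‖a‖ ≤ R := by simpa using ha
      linarith [norm_sub_le ζ a]
    exact indicator_of_mem (show ‖ζ - a‖ ∈ Iic (2 * R) from this) _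
  refine ⟨hgi'.integrableOn.congr_fun heq measurableSet_closedBall, ?_⟩
  rw [← setIntegral_congr_fun measurableSet_closedBall heq, ← hgint,
    ← integral_sub_right_eq_self (fun ζ : ℂ => g ‖ζ‖) a]
  refine setIntegral_le_integral hgi' (Filter.Eventually.of_forall fun ζ => ?_)
  rw [Pi.zero_apply]
  by_cases hζ : ‖ζ - a‖ ∈ Iic (2 * R)
  · simpa only [hg, indicator_of_mem hζ] using Real.rpow_nonneg (norm_nonneg _) _
  · simp [hg, indicator_of_notMem hζ]

/-- The pointwise bound behind the Hölder continuity of the Cauchy transform. -/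
lemma div_mul_le_rpow {α x y d : ℝ} (hα0 : 0 < α) (hα1 : α < 1) (hx : 0 < x) (hy : 0 < y)
    (hd : 0 ≤ d) (hdxy : d ≤ x + y) :
    d / (x * y) ≤ 2 * d ^ α * (x ^ (-(1 + α)) + y ^ (-(1 + α))) := by
  have h1 : d ^ (1 - α) ≤ x ^ (1 - α) + y ^ (1 - α) :=
    (Real.rpow_le_rpow hd hdxy (by linarith)).trans
      (Real.rpow_add_le_add_rpow hx.le hy.le (by linarith) (by linarith))
  have hd' : d = d ^ α * d ^ (1 - α) := by
    rw [← Real.rpow_add_of_nonneg hd hα0.le (by linarith)]; simp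
  -- The mixed product is dominated by the pure power of whichever of `u`, `v` is smaller.
  have cross : ∀ {u v : ℝ}, 0 < u → 0 < v → u ^ (-α) * v ^ (-1 : ℝ) ≤
      u ^ (-(1 + α)) + v ^ (-(1 + α)) := by
    intro u v hu hv
    have e : ∀ {w : ℝ}, 0 < w → w ^ (-(1 + α)) = w ^ (-α) * w ^ (-1 : ℝ) := fun hw => by
      rw [← Real.rpow_add hw]; congr 1; ring
    rcases le_total u v with h | h
    · have : v ^ (-1 : ℝ) ≤ u ^ (-1 : ℝ) := Real.rpow_le_rpow_of_nonpos hu h (by norm_num)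
      have h2 : u ^ (-α) * v ^ (-1 : ℝ) ≤ u ^ (-(1 + α)) := by
        rw [e hu]; gcongr
      have : 0 < v ^ (-(1 + α)) := by positivity
      linarith
    · have : u ^ (-α) ≤ v ^ (-α) := Real.rpow_le_rpow_of_nonpos hv h (by linarith)
      have h2 : u ^ (-α) * v ^ (-1 : ℝ) ≤ v ^ (-(1 + α)) := by
        rw [e hv]; gcongr
      have : 0 < u ^ (-(1 + α)) := by positivity
      linarith
  have hsplit : ∀ {w : ℝ}, 0 < w → w ^ (1 - α) / w = w ^ (-α) := fun {w} hw => by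
    rw [← Real.rpow_sub_one hw.ne']; congr 1; ring
  have hx' := cross hx hy
  have hy' := cross hy hx
  rw [Real.rpow_neg_one] at hx' hy'
  calc d / (x * y) = d ^ α * (d ^ (1 - α) / (x * y)) := by rw [← mul_div_assoc, ← hd']
    _ ≤ d ^ α * ((x ^ (1 - α) + y ^ (1 - α)) / (x * y)) := by gcongr
    _ = d ^ α * (x ^ (1 - α) / x * y⁻¹ + y ^ (1 - α) / y * x⁻¹) := by
      congr 1; field_simp
    _ = d ^ α * (x ^ (-α) * y⁻¹ + y ^ (-α) * x⁻¹) := by rw [hsplit hx, hsplit hy]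
    _ ≤ d ^ α * (2 * (x ^ (-(1 + α)) + y ^ (-(1 + α)))) := by gcongr; linarith
    _ = _ := by ring

/-- The Cauchy transform on the disc with kernel `1 / (φ ζ - φ a)`; for `φ = id` and `φ` the
complex conjugation this gives the one-variable versions of `opT` and `opTbar`. -/
noncomputable def cauchyTransform (φ : ℂ → ℂ) (R : ℝ) (h : ℂ → ℂ) (a : ℂ) : ℂ :=
  (-1 / (2 * (Real.pi : ℂ) * Complex.I)) *
    ∫ ζ in closedBall (0 : ℂ) R, h ζ / (φ ζ - φ a) * (2 * Complex.I)

lemma norm_sub_of_isometry {φ : ℂ → ℂ} (hφ : Isometry φ) (x y : ℂ) :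
    ‖φ x - φ y‖ = ‖x - y‖ := by
  rw [← dist_eq_norm, ← dist_eq_norm, hφ.dist_eq]

lemma norm_cauchy_const : ‖(-1 / (2 * (Real.pi : ℂ) * Complex.I))‖ = 1 / (2 * Real.pi) := by
  simp [abs_of_pos Real.pi_pos]

lemma norm_two_I : ‖(2 * Complex.I : ℂ)‖ = 2 := by simp

section

variable {φ : ℂ → ℂ} {R : ℝ} {h : ℂ → ℂ} {a b : ℂ}

/-- Integrability is what later allows differences to pass through the integral; continuity of `h`
supplies the measurability and boundedness. -/
lemma integrableOn_cauchy (hφ : Isometry φ) (hR : 0 < R)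
    (hc : ContinuousOn h (closedBall 0 R)) (ha : a ∈ closedBall (0 : ℂ) R) :
    IntegrableOn (fun ζ => h ζ / (φ ζ - φ a) * (2 * Complex.I)) (closedBall 0 R) := by
  have hk : IntegrableOn (fun ζ => (φ ζ - φ a)⁻¹) (closedBall (0 : ℂ) R) := by
    refine ((riesz_kernel_bound (s := 1) hR (by norm_num) ha).1).mono' ?_
      (Filter.Eventually.of_forall fun ζ => ?_)
    · exact ((hφ.continuous.measurable.sub_const _).inv).aestronglyMeasurable
    · rw [norm_inv, norm_sub_of_isometry hφ, Real.rpow_neg_one]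
  simpa only [div_eq_mul_inv, IntegrableOn] using
    (hk.continuousOn_mul hc (isCompact_closedBall _ _)).mul_const (2 * Complex.I)

lemma norm_cauchyTransform_le (hφ : Isometry φ) (hR : 0 < R) {M : ℝ}
    (hM : ∀ ζ ∈ closedBall (0 : ℂ) R, ‖h ζ‖ ≤ M) (ha : a ∈ closedBall (0 : ℂ) R) :
    ‖cauchyTransform φ R h a‖ ≤ 4 * R * M := by
  have hM0 : 0 ≤ M := (norm_nonneg _).trans (hM a ha)
  obtain ⟨hi, hb⟩ := riesz_kernel_bound (s := 1) hR (by norm_num) ha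
  have h1 : ‖∫ ζ in closedBall (0 : ℂ) R, h ζ / (φ ζ - φ a) * (2 * Complex.I)‖ ≤
      ∫ ζ in closedBall (0 : ℂ) R, 2 * M * ‖ζ - a‖ ^ (-1 : ℝ) := by
    refine norm_integral_le_of_norm_le (hi.const_mul _) ?_
    refine (ae_restrict_mem measurableSet_closedBall).mono fun ζ hζ => ?_
    rw [norm_mul, norm_div, norm_two_I, norm_sub_of_isometry hφ, Real.rpow_neg_one,
      div_eq_mul_inv]
    calc ‖h ζ‖ * ‖ζ - a‖⁻¹ * 2 ≤ M * ‖ζ - a‖⁻¹ * 2 := by gcongr; exact hM ζ hζ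
      _ = _ := by ring
  rw [integral_const_mul] at h1
  rw [cauchyTransform, norm_mul, norm_cauchy_const]
  calc _ ≤ 1 / (2 * Real.pi) * (2 * M * (2 * Real.pi * ((2 * R) ^ (2 - 1 : ℝ) / (2 - 1)))) := by
        gcongr; exact h1.trans (by gcongr)
    _ = 4 * R * M := by
      norm_num
      field_simp
      ring

/-- The difference of the kernels is `(φ a - φ b) / ((φ ζ - φ a) (φ ζ - φ b))`, which
`div_mul_le_rpow` bounds by `‖a - b‖ ^ α` times two integrable singularities of order `1 + α < 2`.
Only the sup of `h` enters the constant, so a Hölder order is gained. -/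
lemma norm_cauchyTransform_sub_le (hφ : Isometry φ) (hR : 0 < R) {α : ℝ} (hα0 : 0 < α)
    (hα1 : α < 1) (hc : ContinuousOn h (closedBall 0 R)) {M : ℝ}
    (hM : ∀ ζ ∈ closedBall (0 : ℂ) R, ‖h ζ‖ ≤ M) (ha : a ∈ closedBall (0 : ℂ) R)
    (hb : b ∈ closedBall (0 : ℂ) R) :
    ‖cauchyTransform φ R h a - cauchyTransform φ R h b‖ ≤
      8 / (1 - α) * (2 * R) ^ (1 - α) * M * ‖a - b‖ ^ α := by
  have hM0 : 0 ≤ M := (norm_nonneg _).trans (hM a ha)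
  obtain ⟨hia, hba⟩ := riesz_kernel_bound (s := 1 + α) hR (by linarith) ha
  obtain ⟨hib, hbb⟩ := riesz_kernel_bound (s := 1 + α) hR (by linarith) hb
  rw [show 2 - (1 + α) = 1 - α by ring] at hba hbb
  have hα' : 0 < 1 - α := by linarith
  have h1 : ‖∫ ζ in closedBall (0 : ℂ) R, (h ζ / (φ ζ - φ a) * (2 * Complex.I) -
      h ζ / (φ ζ - φ b) * (2 * Complex.I))‖ ≤
      ∫ ζ in closedBall (0 : ℂ) R, 4 * M * ‖a - b‖ ^ α *
        (‖ζ - a‖ ^ (-(1 + α)) + ‖ζ - b‖ ^ (-(1 + α))) := by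
    refine norm_integral_le_of_norm_le ((hia.add hib).const_mul _) ?_
    -- The null set `{a, b}` is discarded, since the kernel identity needs nonzero denominators.
    filter_upwards [ae_restrict_mem measurableSet_closedBall,
      ae_restrict_of_ae (Measure.ae_ne volume a), ae_restrict_of_ae (Measure.ae_ne volume b)]
      with ζ hζ hζa hζb
    have hxa : 0 < ‖ζ - a‖ := norm_pos_iff.2 (sub_ne_zero.2 hζa)
    have hxb : 0 < ‖ζ - b‖ := norm_pos_iff.2 (sub_ne_zero.2 hζb)
    have hφa : φ ζ - φ a ≠ 0 := sub_ne_zero.2 (hφ.injective.ne hζa)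
    have hφb : φ ζ - φ b ≠ 0 := sub_ne_zero.2 (hφ.injective.ne hζb)
    have e : h ζ / (φ ζ - φ a) * (2 * Complex.I) - h ζ / (φ ζ - φ b) * (2 * Complex.I) =
        h ζ * ((φ a - φ b) / ((φ ζ - φ a) * (φ ζ - φ b))) * (2 * Complex.I) := by
      field_simp; ring
    rw [e, norm_mul, norm_mul, norm_div, norm_mul, norm_two_I, norm_sub_of_isometry hφ,
      norm_sub_of_isometry hφ, norm_sub_of_isometry hφ]
    have hd : ‖a - b‖ ≤ ‖ζ - a‖ + ‖ζ - b‖ := by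
      calc ‖a - b‖ = ‖(ζ - b) - (ζ - a)‖ := by congr 1; ring
        _ ≤ _ := by linarith [norm_sub_le (ζ - b) (ζ - a)]
    have := div_mul_le_rpow hα0 hα1 hxa hxb (norm_nonneg (a - b)) hd
    calc ‖h ζ‖ * (‖a - b‖ / (‖ζ - a‖ * ‖ζ - b‖)) * 2 ≤
          M * (2 * ‖a - b‖ ^ α * (‖ζ - a‖ ^ (-(1 + α)) + ‖ζ - b‖ ^ (-(1 + α)))) * 2 := by
          gcongr; exact hM ζ hζ
      _ = _ := by ring
  rw [integral_const_mul, integral_add hia hib, integral_sub (integrableOn_cauchy hφ hR hc ha)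
    (integrableOn_cauchy hφ hR hc hb)] at h1
  rw [cauchyTransform, cauchyTransform, ← mul_sub, norm_mul, norm_cauchy_const]
  calc _ ≤ 1 / (2 * Real.pi) * (4 * M * ‖a - b‖ ^ α *
        (2 * Real.pi * ((2 * R) ^ (1 - α) / (1 - α)) +
          2 * Real.pi * ((2 * R) ^ (1 - α) / (1 - α)))) := by
        gcongr; exact h1.trans (by gcongr)
    _ = _ := by
      field_simp
      ring

end

/-! ### Iterated differences and their commutation with the transform in one variable. -/

variable {n : ℕ} {R α : ℝ} {f g : (Fin n → ℂ) → ℂ}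

lemma update_mem_polydisc {z : Fin n → ℂ} (hz : z ∈ polydisc n R) {w : ℂ}
    (hw : w ∈ closedBall (0 : ℂ) R) (i : Fin n) : Function.update z i w ∈ polydisc n R := by
  intro j
  rcases eq_or_ne j i with rfl | h
  · simpa using hw
  · simpa [Function.update_of_ne h] using hz j

/-- This makes the order of the list irrelevant, so that a chosen variable can be moved to the end.
-/
instance iterDiff_step_rightCommutative (z' : Fin n → ℂ) :
    RightCommutative fun (g : (Fin n → ℂ) → ℂ) i => diff i (z' i) g where
  right_comm g i j := by
    rcases eq_or_ne i j with rfl | h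
    · rfl
    · funext z
      simp only [diff]
      rw [Function.update_comm h]
      ring

lemma iterDiff_perm {l l' : List (Fin n)} (h : l.Perm l') (z' : Fin n → ℂ)
    (f : (Fin n → ℂ) → ℂ) : iterDiff l z' f = iterDiff l' z' f :=
  h.foldl_eq f

lemma iterDiff_concat (l : List (Fin n)) (j : Fin n) (z' : Fin n → ℂ)
    (f : (Fin n → ℂ) → ℂ) : iterDiff (l ++ [j]) z' f = diff j (z' j) (iterDiff l z' f) := by
  simp [iterDiff]

lemma diff_eqOn (hfg : EqOn f g (polydisc n R)) (i : Fin n) {w : ℂ}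
    (hw : w ∈ closedBall (0 : ℂ) R) : EqOn (diff i w f) (diff i w g) (polydisc n R) := by
  intro z hz
  simp only [diff]
  rw [hfg hz, hfg (update_mem_polydisc hz hw i)]

lemma iterDiff_eqOn (l : List (Fin n)) {z' : Fin n → ℂ} (hz' : z' ∈ polydisc n R)
    (hfg : EqOn f g (polydisc n R)) :
    EqOn (iterDiff l z' f) (iterDiff l z' g) (polydisc n R) := by
  induction l generalizing f g with
  | nil => exact hfg
  | cons i l ih => exact ih (diff_eqOn hfg i (hz' i))

/-- Continuity in each variable separately, on the closed polydisc. -/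
def SliceContinuous (R : ℝ) (f : (Fin n → ℂ) → ℂ) : Prop :=
  ∀ z ∈ polydisc n R, ∀ j, ContinuousOn (fun ζ => f (Function.update z j ζ)) (closedBall 0 R)

lemma SliceContinuous.diff (hf : SliceContinuous R f) (i : Fin n) {w : ℂ}
    (hw : w ∈ closedBall (0 : ℂ) R) : SliceContinuous R (diff i w f) := by
  intro z hz j
  refine (hf z hz j).sub ?_
  rcases eq_or_ne i j with rfl | h
  · simpa using continuousOn_const
  · simpa only [Function.update_comm h.symm] using hf _ (update_mem_polydisc hz hw i) j

lemma SliceContinuous.iterDiff (hf : SliceContinuous R f) (l : List (Fin n)) {z' : Fin n → ℂ}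
    (hz' : z' ∈ polydisc n R) : SliceContinuous R (iterDiff l z' f) := by
  induction l generalizing f with
  | nil => exact hf
  | cons i l ih => exact ih (hf.diff i (hz' i))

/-- The Cauchy transform in the `j`-th variable. For `φ = id` and `φ` the complex conjugation it is
definitionally `opT` and `opTbar`. -/
noncomputable def opCauchy (φ : ℂ → ℂ) (R : ℝ) (j : Fin n) (f : (Fin n → ℂ) → ℂ) :
    (Fin n → ℂ) → ℂ :=
  fun z => cauchyTransform φ R (fun ζ => f (Function.update z j ζ)) (z j)

lemma opCauchy_update (φ : ℂ → ℂ) (j : Fin n) (z : Fin n → ℂ) (w : ℂ) :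
    opCauchy φ R j f (Function.update z j w) =
      cauchyTransform φ R (fun ζ => f (Function.update z j ζ)) w := by
  simp [opCauchy]

section

variable {φ : ℂ → ℂ}

/-- The kernel sees only `z j`, so for `i ≠ j` this is linearity of the integral. -/
lemma diff_opCauchy (hφ : Isometry φ) (hR : 0 < R) (hf : SliceContinuous R f) {i j : Fin n}
    (hij : i ≠ j) {w : ℂ} (hw : w ∈ closedBall (0 : ℂ) R) :
    EqOn (diff i w (opCauchy φ R j f)) (opCauchy φ R j (diff i w f)) (polydisc n R) := by
  intro z hz
  have h1 := integrableOn_cauchy hφ hR (hf z hz j) (hz j)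
  have h2 := integrableOn_cauchy hφ hR (hf _ (update_mem_polydisc hz hw i) j) (hz j)
  simp only [Function.update_comm hij] at h2
  simp only [diff, opCauchy, cauchyTransform, Function.update_of_ne hij.symm,
    Function.update_comm hij]
  rw [← mul_sub, ← integral_sub h1 h2]
  simp only [sub_div, sub_mul]

lemma iterDiff_opCauchy (hφ : Isometry φ) (hR : 0 < R) (hf : SliceContinuous R f) {j : Fin n}
    {l : List (Fin n)} (hj : j ∉ l) {z' : Fin n → ℂ} (hz' : z' ∈ polydisc n R) :
    EqOn (iterDiff l z' (opCauchy φ R j f)) (opCauchy φ R j (iterDiff l z' f))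
      (polydisc n R) := by
  induction l generalizing f with
  | nil => exact fun z _ => rfl
  | cons i l ih =>
    rw [List.mem_cons, not_or] at hj
    exact (iterDiff_eqOn l hz' (diff_opCauchy hφ hR hf (Ne.symm hj.1) (hz' i))).trans
      (ih (hf.diff i (hz' i)) hj.2)

end

/-! ### Difference quotients -/

/-- The denominator of a difference quotient. -/
noncomputable def weight (α : ℝ) (l : List (Fin n)) (z z' : Fin n → ℂ) : ℝ :=
  (l.map fun i => ‖z i - z' i‖ ^ α).prod

lemma weight_nonneg (l : List (Fin n)) (z z' : Fin n → ℂ) : 0 ≤ weight α l z z' := by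
  refine List.prod_nonneg fun a ha => ?_
  obtain ⟨i, -, rfl⟩ := List.mem_map.1 ha
  positivity

lemma weight_pos {l : List (Fin n)} {z z' : Fin n → ℂ} (h : ∀ i ∈ l, z i ≠ z' i) :
    0 < weight α l z z' := by
  refine List.prod_pos fun a ha => ?_
  obtain ⟨i, hi, rfl⟩ := List.mem_map.1 ha
  exact Real.rpow_pos_of_pos (norm_pos_iff.2 (sub_ne_zero.2 (h i hi))) _

lemma weight_update {l : List (Fin n)} {j : Fin n} (hj : j ∉ l) (z z' : Fin n → ℂ) (w : ℂ) :
    weight α l (Function.update z j w) z' = weight α l z z' := by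
  unfold weight
  congr 1
  refine List.map_congr_left fun i hi => ?_
  rw [Function.update_of_ne (ne_of_mem_of_not_mem hi hj)]

lemma holderSup_nonneg (k : ℕ) : 0 ≤ holderSup R α k f := by
  refine Real.sSup_nonneg ?_
  rintro q ⟨l, -, -, z, -, z', -, -, rfl⟩
  exact div_nonneg (norm_nonneg _) (weight_nonneg l z z')

lemma MemHolder.norm_iterDiff_le (hf : MemHolder R α f) {l : List (Fin n)} (hl : l.Nodup)
    {z z' : Fin n → ℂ} (hz : z ∈ polydisc n R) (hz' : z' ∈ polydisc n R)
    (hne : ∀ i ∈ l, z i ≠ z' i) :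
    ‖iterDiff l z' f z‖ ≤ holderSup R α l.length f * weight α l z z' := by
  rw [← div_le_iff₀ (weight_pos hne)]
  refine le_csSup (hf _ ?_) ⟨l, hl, rfl, z, hz, z', hz', hne, rfl⟩
  simpa using hl.length_le_card

/-- Quotients of order one, for the list `[j]`, give `α`-Hölder continuity in the variable `j`. -/
lemma MemHolder.sliceContinuous (hα : 0 < α) (hf : MemHolder R α f) : SliceContinuous R f := by
  intro z hz j
  have hbd : ∀ x ∈ closedBall (0 : ℂ) R, ∀ y ∈ closedBall (0 : ℂ) R,
      ‖f (Function.update z j x) - f (Function.update z j y)‖ ≤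
        holderSup R α 1 f * ‖x - y‖ ^ α := by
    intro x hx y hy
    rcases eq_or_ne x y with rfl | hxy
    · simp [Real.zero_rpow hα.ne']
    · simpa [iterDiff, diff, weight] using hf.norm_iterDiff_le (List.nodup_singleton j)
        (update_mem_polydisc hz hx j) (update_mem_polydisc hz hy j) (by simpa using hxy)
  intro x hx
  rw [ContinuousWithinAt, tendsto_iff_norm_sub_tendsto_zero]
  have hlim : Filter.Tendsto (fun y => holderSup R α 1 f * ‖y - x‖ ^ α)
      (nhdsWithin x (closedBall 0 R)) (nhds 0) := by
    have : Continuous fun y : ℂ => holderSup R α 1 f * ‖y - x‖ ^ α :=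
      continuous_const.mul ((continuous_id.sub continuous_const).norm.rpow_const
        fun _ => Or.inr hα.le)
    have h0 := this.tendsto x
    simp only [sub_self, norm_zero, Real.zero_rpow hα.ne', mul_zero] at h0
    exact h0.mono_left nhdsWithin_le_nhds
  refine squeeze_zero' (Filter.Eventually.of_forall fun _ => norm_nonneg _) ?_ hlim
  filter_upwards [self_mem_nhdsWithin] with y hy using hbd y hy x hx

/-! ### The action of one operator on difference quotients and on the norm. -/

section

variable {φ : ℂ → ℂ}

lemma norm_iterDiff_opCauchy_le_of_notMem (hφ : Isometry φ) (hR : 0 < R) (hα0 : 0 < α)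
    (hf : MemHolder R α f) {j : Fin n} {l : List (Fin n)} (hl : l.Nodup) (hj : j ∉ l)
    {z z' : Fin n → ℂ} (hz : z ∈ polydisc n R) (hz' : z' ∈ polydisc n R)
    (hne : ∀ i ∈ l, z i ≠ z' i) :
    ‖iterDiff l z' (opCauchy φ R j f) z‖ ≤
      4 * R * holderSup R α l.length f * weight α l z z' := by
  rw [iterDiff_opCauchy hφ hR (hf.sliceContinuous hα0) hj hz' hz, mul_assoc]
  refine norm_cauchyTransform_le hφ hR (fun ζ hζ => ?_) (hz j)
  rw [← weight_update hj z z' ζ]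
  refine hf.norm_iterDiff_le hl (update_mem_polydisc hz hζ j) hz' fun i hi => ?_
  rw [Function.update_of_ne (ne_of_mem_of_not_mem hi hj)]
  exact hne i hi

/-- With `j` moved last, the outer difference compares the transform of a single function at `z j`
and `z' j`. That function is an iterated difference over `l.erase j`, whence the order `l.length -
1`. -/
lemma norm_iterDiff_opCauchy_le_of_mem (hφ : Isometry φ) (hR : 0 < R) (hα0 : 0 < α)
    (hα1 : α < 1) (hf : MemHolder R α f) {j : Fin n} {l : List (Fin n)} (hl : l.Nodup)
    (hj : j ∈ l) {z z' : Fin n → ℂ} (hz : z ∈ polydisc n R) (hz' : z' ∈ polydisc n R)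
    (hne : ∀ i ∈ l, z i ≠ z' i) :
    ‖iterDiff l z' (opCauchy φ R j f) z‖ ≤
      8 / (1 - α) * (2 * R) ^ (1 - α) * holderSup R α (l.length - 1) f * weight α l z z' := by
  have hperm : l.Perm (l.erase j ++ [j]) :=
    (List.perm_cons_erase hj).trans (List.perm_append_singleton j _).symm
  have hj' : j ∉ l.erase j := hl.not_mem_erase
  have hcomm := iterDiff_opCauchy hφ hR (hf.sliceContinuous hα0) hj' hz'
  have hw : weight α l z z' = weight α (l.erase j) z z' * ‖z j - z' j‖ ^ α := by
    rw [weight, (hperm.map _).prod_eq]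
    simp [weight]
  rw [iterDiff_perm hperm, iterDiff_concat, diff, hcomm hz,
    hcomm (update_mem_polydisc hz (hz' j) j), opCauchy_update, opCauchy, hw,
    ← List.length_erase_of_mem hj]
  have hc := (hf.sliceContinuous hα0).iterDiff (l.erase j) hz' z hz j
  refine (norm_cauchyTransform_sub_le hφ hR hα0 hα1 hc
    (M := holderSup R α (l.erase j).length f * weight α (l.erase j) z z')
    (fun ζ hζ => ?_) (hz j) (hz' j)).trans (le_of_eq (by ring))
  rw [← weight_update hj' z z' ζ]
  refine hf.norm_iterDiff_le (hl.erase j) (update_mem_polydisc hz hζ j) hz' fun i hi => ?_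
  rw [Function.update_of_ne (ne_of_mem_of_not_mem hi hj')]
  exact hne i (List.mem_of_mem_erase hi)

lemma quotientSet_zero_opCauchy_le (hφ : Isometry φ) (hR : 0 < R) (hα0 : 0 < α)
    (hf : MemHolder R α f) (j : Fin n) :
    ∀ q ∈ quotientSet R α 0 (opCauchy φ R j f), q ≤ 4 * R * holderSup R α 0 f := by
  rintro q ⟨l, hl, hk, z, hz, z', hz', hne, rfl⟩
  obtain rfl := List.length_eq_zero_iff.1 hk
  exact (div_le_iff₀ (weight_pos hne)).2
    (norm_iterDiff_opCauchy_le_of_notMem hφ hR hα0 hf hl List.not_mem_nil hz hz' hne)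

lemma quotientSet_succ_opCauchy_le (hφ : Isometry φ) (hR : 0 < R) (hα0 : 0 < α) (hα1 : α < 1)
    (hf : MemHolder R α f) (j : Fin n) (k : ℕ) :
    ∀ q ∈ quotientSet R α (k + 1) (opCauchy φ R j f), q ≤ 4 * R * holderSup R α (k + 1) f +
      8 / (1 - α) * (2 * R) ^ (1 - α) * holderSup R α k f := by
  rintro q ⟨l, hl, hk, z, hz, z', hz', hne, rfl⟩
  refine (div_le_iff₀ (weight_pos hne)).2 ?_
  have hα' : 0 < 1 - α := by linarith
  have h1 : 0 ≤ 4 * R * holderSup R α (k + 1) f * weight α l z z' :=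
    mul_nonneg (mul_nonneg (by positivity) (holderSup_nonneg _)) (weight_nonneg _ _ _)
  have h2 : 0 ≤ 8 / (1 - α) * (2 * R) ^ (1 - α) * holderSup R α k f * weight α l z z' :=
    mul_nonneg (mul_nonneg (by positivity) (holderSup_nonneg _)) (weight_nonneg _ _ _)
  change _ ≤ _ * weight α l z z'
  rw [add_mul]
  by_cases hj : j ∈ l
  · have := norm_iterDiff_opCauchy_le_of_mem hφ hR hα0 hα1 hf hl hj hz hz' hne
    rw [hk, Nat.add_sub_cancel] at this
    linarith
  · have := norm_iterDiff_opCauchy_le_of_notMem hφ hR hα0 hf hl hj hz hz' hne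
    rw [hk] at this
    linarith

lemma memHolder_opCauchy (hφ : Isometry φ) (hR : 0 < R) (hα0 : 0 < α) (hα1 : α < 1)
    (hf : MemHolder R α f) (j : Fin n) : MemHolder R α (opCauchy φ R j f) := by
  rintro (_ | k) -
  · exact ⟨_, quotientSet_zero_opCauchy_le hφ hR hα0 hf j⟩
  · exact ⟨_, quotientSet_succ_opCauchy_le hφ hR hα0 hα1 hf j k⟩

lemma holderSup_zero_opCauchy_le (hφ : Isometry φ) (hR : 0 < R) (hα0 : 0 < α)
    (hf : MemHolder R α f) (j : Fin n) :
    holderSup R α 0 (opCauchy φ R j f) ≤ 4 * R * holderSup R α 0 f :=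
  Real.sSup_le (quotientSet_zero_opCauchy_le hφ hR hα0 hf j)
    (mul_nonneg (by positivity) (holderSup_nonneg _))

lemma holderSup_succ_opCauchy_le (hφ : Isometry φ) (hR : 0 < R) (hα0 : 0 < α) (hα1 : α < 1)
    (hf : MemHolder R α f) (j : Fin n) (k : ℕ) :
    holderSup R α (k + 1) (opCauchy φ R j f) ≤ 4 * R * holderSup R α (k + 1) f +
      8 / (1 - α) * (2 * R) ^ (1 - α) * holderSup R α k f := by
  have hα' : 0 < 1 - α := by linarith
  -- Nonnegativity of the bound covers an empty quotient set (`k + 1 > n`), whose `sSup` is `0`.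
  exact Real.sSup_le (quotientSet_succ_opCauchy_le hφ hR hα0 hα1 hf j k)
    (add_nonneg (mul_nonneg (by positivity) (holderSup_nonneg _))
      (mul_nonneg (by positivity) (holderSup_nonneg _)))

/-- A weight of order `k + 1` absorbs the loss of one Hölder order. -/
lemma rpow_div_factorial_succ_le (hR : 0 < R) (k : ℕ) :
    (2 * R) ^ (((k + 1 : ℕ) : ℝ) * α) / ((k + 1).factorial : ℝ) * (2 * R) ^ (1 - α) ≤
      2 * R * ((2 * R) ^ ((k : ℝ) * α) / (k.factorial : ℝ)) := by
  have h2R : 0 < 2 * R := by positivity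
  have e : (2 * R) ^ (((k + 1 : ℕ) : ℝ) * α) * (2 * R) ^ (1 - α) =
      2 * R * (2 * R) ^ ((k : ℝ) * α) := by
    rw [← Real.rpow_add h2R, show ((k + 1 : ℕ) : ℝ) * α + (1 - α) = 1 + k * α by push_cast; ring,
      Real.rpow_add h2R, Real.rpow_one]
  rw [div_mul_eq_mul_div, e, mul_div_assoc]
  gcongr
  exact Nat.le_succ k

lemma holderNorm_opCauchy_le (hφ : Isometry φ) (hR : 0 < R) (hα0 : 0 < α) (hα1 : α < 1)
    (hf : MemHolder R α f) (j : Fin n) :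
    holderNorm R α (opCauchy φ R j f) ≤ (4 + 16 / (1 - α)) * R * holderNorm R α f := by
  have hα' : 0 < 1 - α := by linarith
  set c : ℕ → ℝ := fun k => (2 * R) ^ ((k : ℝ) * α) / (k.factorial : ℝ) with hc
  have hc0 : ∀ k, 0 ≤ c k := fun k => by positivity
  set K := 8 / (1 - α) with hK
  have hK0 : 0 < K := by positivity
  have hterm : ∀ k, c (k + 1) * holderSup R α (k + 1) (opCauchy φ R j f) ≤
      4 * R * (c (k + 1) * holderSup R α (k + 1) f) +
        2 * R * K * (c k * holderSup R α k f) := by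
    intro k
    have h1 := mul_le_mul_of_nonneg_left
      (holderSup_succ_opCauchy_le hφ hR hα0 hα1 hf j k) (hc0 (k + 1))
    have h2 := mul_le_mul_of_nonneg_right (rpow_div_factorial_succ_le (α := α) hR k)
      (mul_nonneg hK0.le (holderSup_nonneg (R := R) (α := α) (f := f) k))
    refine h1.trans ?_
    calc _ = 4 * R * (c (k + 1) * holderSup R α (k + 1) f) +
          c (k + 1) * (2 * R) ^ (1 - α) * (K * holderSup R α k f) := by ring
      _ ≤ 4 * R * (c (k + 1) * holderSup R α (k + 1) f) +
          2 * R * c k * (K * holderSup R α k f) := by gcongr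
      _ = _ := by ring
  have hzero := mul_le_mul_of_nonneg_left (holderSup_zero_opCauchy_le hφ hR hα0 hf j) (hc0 0)
  -- The terms that drop one order run over `0, …, n - 1`, so their sum is the norm without its top
  -- term.
  have hlast : ∑ k ∈ Finset.range n, c k * holderSup R α k f ≤ holderNorm R α f := by
    rw [holderNorm, Finset.sum_range_succ]
    exact le_add_of_nonneg_right (mul_nonneg (hc0 n) (holderSup_nonneg n))
  have hfirst : holderNorm R α f = (∑ k ∈ Finset.range n, c (k + 1) * holderSup R α (k + 1) f) +
      c 0 * holderSup R α 0 f := Finset.sum_range_succ' _ _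
  have hsum := Finset.sum_le_sum fun k (_ : k ∈ Finset.range n) => hterm k
  rw [Finset.sum_add_distrib, ← Finset.mul_sum, ← Finset.mul_sum] at hsum
  calc holderNorm R α (opCauchy φ R j f)
      = (∑ k ∈ Finset.range n, c (k + 1) * holderSup R α (k + 1) (opCauchy φ R j f)) +
          c 0 * holderSup R α 0 (opCauchy φ R j f) := Finset.sum_range_succ' _ _
    _ ≤ 4 * R * holderNorm R α f +
          2 * R * K * ∑ k ∈ Finset.range n, c k * holderSup R α k f := by
        rw [hfirst]; linarith
    _ ≤ 4 * R * holderNorm R α f + 2 * R * K * holderNorm R α f := by gcongr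
    _ = _ := by rw [hK]; ring

end

/-! ### Iteration over multi-indices. -/

/-- The index of `P` counts applied operators. The start `m` is arbitrary so that the lemma can be
applied to the `T̄` block and then, on top of it, to the `T` block. -/
lemma multiPow_induction {X : Type*} {P : ℕ → X → Prop} {A : Fin n → X → X}
    (hA : ∀ j m x, P m x → P (m + 1) (A j x)) (μ : Fin n → ℕ) {m : ℕ} {x : X} (hx : P m x) :
    P ((∑ j, μ j) + m) (multiPow A μ x) := by
  have hiter : ∀ j k m x, P m x → P (k + m) ((A j)^[k] x) := by
    intro j k m x hx
    induction k with
    | zero => simpa using hx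
    | succ k ih =>
      rw [Function.iterate_succ_apply', Nat.add_right_comm]
      exact hA j _ _ ih
  rw [Fin.sum_univ_def, multiPow]
  induction List.finRange n with
  | nil => simpa using hx
  | cons j l ih =>
    rw [List.map_cons, List.sum_cons, List.foldr_cons, add_assoc]
    exact hiter j _ _ _ ih

end Polydisc

theorem proposition3p1 (α : ℝ) (hα0 : 0 < α) (hα1 : α < 1) :
    ∃ C : ℝ, 0 < C ∧
      ∀ (n : ℕ) (R : ℝ), 0 < R →
        ∀ (f : (Fin n → ℂ) → ℂ), Polydisc.MemHolder R α f →
          ∀ (μ ν : Fin n → ℕ) (m : ℕ), (∑ j, μ j) + (∑ j, ν j) = m →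
            Polydisc.MemHolder R α (Polydisc.green R μ ν f) ∧
              Polydisc.holderNorm R α (Polydisc.green R μ ν f) ≤
                (C * R) ^ m * Polydisc.holderNorm R α f := by
  have hα' : 0 < 1 - α := by linarith
  refine ⟨4 + 16 / (1 - α), by positivity, ?_⟩
  rintro n R hR f hf μ ν m rfl
  -- Membership is carried along with the norm bound, because the one-operator estimate requires it
  -- of its input.
  set P : ℕ → ((Fin n → ℂ) → ℂ) → Prop := fun m g => Polydisc.MemHolder R α g ∧
    Polydisc.holderNorm R α g ≤ ((4 + 16 / (1 - α)) * R) ^ m * Polydisc.holderNorm R α f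
    with hP
  have hstep : ∀ φ : ℂ → ℂ, Isometry φ → ∀ j m g, P m g →
      P (m + 1) (Polydisc.opCauchy φ R j g) := by
    rintro φ hφ j m g ⟨hg, hgn⟩
    refine ⟨Polydisc.memHolder_opCauchy hφ hR hα0 hα1 hg j,
      (Polydisc.holderNorm_opCauchy_le hφ hR hα0 hα1 hg j).trans ?_⟩
    rw [pow_succ', mul_assoc (_ * R)]
    gcongr
  have h0 : P 0 f := ⟨hf, by simp⟩
  have hν := Polydisc.multiPow_induction (A := Polydisc.opTbar R)
    (hstep (starRingEnd ℂ) Complex.isometry_conj) ν h0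
  exact Polydisc.multiPow_induction (A := Polydisc.opT R) (hstep id isometry_id) μ hν
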